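/- The Sierpinski space is $\mathbb S=\{0,1\}$ with open sets $\emptyset,\{1\},\{0,1\}$. A subset of a topological space is $\mathbf\Pi^0_2$ if it has the form $\bigcap_{n\in\mathbb N}\bigl((Z\setminus U_n)\cup V_n\bigr)$ with all $U_n,V_n$ open in the space $Z$. A topological space is \emph{quasi-Polish} if it is homeomorphic to a $\mathbf\Pi^0_2$ subspace of $\mathbb S^I$ (with the product topology) for some countable set $I$. \textbf{Theorem.} Let $f : X \to Y$ be a continuous open map between quasi-Polish spaces. Then $f$ admits a Borel section on its image: there is a Borel map $s : f(X) \to X$ (where $f(X)\subseteq Y$ carries the subspace topology) such that $f(s(y)) = y$ for every $y \in f(X)$, i.e. $f\circ s = 1_{f(X)}$. -/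

import Mathlib

/-- `S` is `Π⁰₂` in an arbitrary topological space: the complement of a set of the form
`⋃ n, U n \ V n` with all `U n`, `V n` open. -/
def IsPiZeroTwo {X : Type*} [TopologicalSpace X] (S : Set X) : Prop :=
  ∃ U V : ℕ → Set X, (∀ n, IsOpen (U n)) ∧ (∀ n, IsOpen (V n)) ∧ S = ⋂ n, ((U n)ᶜ ∪ V n)

/-- A space is quasi-Polish if it is homeomorphic to a `Π⁰₂` subspace of a power of the Sierpinski
space with countable index set `I`. Here `Prop` carries Mathlib's Sierpinski topology (`{True}` is
open and not closed), and `I → Prop` the product topology. -/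
def IsQuasiPolish (X : Type*) [TopologicalSpace X] : Prop :=
  ∃ I : Type, Countable I ∧ ∃ S : Set (I → Prop), IsPiZeroTwo S ∧ Nonempty (X ≃ₜ S)

open Set

/-! Embed `X` as a `Π⁰₂` set `S` of `I → Prop`. For `y` in the image, build increasing finite sets
`F n y` whose cylinders all meet the fibre over `y`; the section value is their union. As `f` is
open, "the cylinder over `G` meets the fibre" is an open condition on `y`, so choices from the
countable set `Finset I` can be made measurably (`exists_measurable_seq`). A fibre point lies in
`S`, so the next cylinder can always be shrunk to meet one more condition; this puts the limit in
`S` and over `y`. -/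

/-- The basic open set of the points of `I → Prop` that are true on the finite set `F`. -/
def sierpinskiCylinder {I : Type*} (F : Finset I) : Set (I → Prop) := {x | ∀ i ∈ F, x i}

theorem isOpen_sierpinskiCylinder {I : Type*} (F : Finset I) :
    IsOpen (sierpinskiCylinder F) := by
  have h : sierpinskiCylinder F = ⋂ i ∈ F, (fun x : I → Prop => x i) ⁻¹' {True} := by
    ext x
    simp [sierpinskiCylinder]
  rw [h]
  exact isOpen_biInter_finset fun i _ => isOpen_singleton_true.preimage (continuous_apply i)

theorem sierpinskiCylinder_anti {I : Type*} {F G : Finset I} (h : F ⊆ G) :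
    sierpinskiCylinder G ⊆ sierpinskiCylinder F :=
  fun _ hx i hi => hx i (h hi)

theorem exists_sierpinskiCylinder_subset {I : Type*} {U : Set (I → Prop)} (hU : IsOpen U)
    {x : I → Prop} (hx : x ∈ U) :
    ∃ F : Finset I, x ∈ sierpinskiCylinder F ∧ sierpinskiCylinder F ⊆ U := by
  classical
  obtain ⟨F, u, hu, hsub⟩ := isOpen_pi_iff.1 hU x hx
  refine ⟨F.filter x, fun i hi => (Finset.mem_filter.1 hi).2, fun z hz => hsub fun i hi => ?_⟩
  obtain ⟨ho, hxi⟩ := hu i hi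
  by_cases h : x i
  · have hzi : z i := hz i (Finset.mem_filter.2 ⟨hi, h⟩)
    rwa [show z i = x i from propext ⟨fun _ => h, fun _ => hzi⟩]
  -- The only neighbourhood of `False` is the whole space, so false coordinates impose no
  -- constraint.
  · rw [show x i = False from propext ⟨h, False.elim⟩] at hxi
    have hn := ho.mem_nhds hxi
    rw [nhds_false, Filter.mem_top] at hn
    rw [hn]
    trivial

/-- An open set containing the union of an increasing sequence of finite sets contains the cylinder
over one of them. -/
theorem exists_sierpinskiCylinder_subset_of_monotone {I : Type*} {F : ℕ → Finset I}
    (hF : Monotone F) {U : Set (I → Prop)} (hU : IsOpen U) (hx : (fun i => ∃ k, i ∈ F k) ∈ U) :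
    ∃ k, sierpinskiCylinder (F k) ⊆ U := by
  obtain ⟨G, hG, hGU⟩ := exists_sierpinskiCylinder_subset hU hx
  choose! k hk using hG
  exact ⟨G.sup k, (sierpinskiCylinder_anti fun i hi =>
    hF (Finset.le_sup hi) (hk i hi)).trans hGU⟩

/-- A family of nonempty measurable choices from a countable set has a measurable selector. -/
theorem exists_measurable_selector {Z C : Type*} [MeasurableSpace Z] [Countable C] [Nonempty C]
    [MeasurableSpace C] [DiscreteMeasurableSpace C] (P : Z → C → Prop)
    (hP : ∀ c, MeasurableSet {z | P z c}) (hex : ∀ z, ∃ c, P z c) :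
    ∃ g : Z → C, Measurable g ∧ ∀ z, P z (g z) := by
  classical
  obtain ⟨e, he⟩ := exists_surjective_nat C
  have hex' : ∀ z, ∃ n, P z (e n) := fun z => by
    obtain ⟨c, hc⟩ := hex z
    obtain ⟨n, rfl⟩ := he c
    exact ⟨n, hc⟩
  exact ⟨fun z => e (Nat.find (hex' z)),
    (measurable_from_nat (f := e)).comp (measurable_find hex' fun n => hP (e n)),
    fun z => Nat.find_spec (hex' z)⟩

/-- Measurable dependent choice in a countable set. -/
theorem exists_measurable_seq {Z C : Type*} [MeasurableSpace Z] [Countable C]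
    [MeasurableSpace C] [DiscreteMeasurableSpace C] (Q : Z → C → Prop) (R : ℕ → Z → C → C → Prop)
    (hQ : ∀ c, MeasurableSet {z | Q z c}) (hR : ∀ n c d, MeasurableSet {z | R n z c d})
    (c₀ : C) (h₀ : ∀ z, Q z c₀) (hex : ∀ n z c, Q z c → ∃ d, Q z d ∧ R n z c d) :
    ∃ g : ℕ → Z → C, (∀ n, Measurable (g n)) ∧ (∀ n z, Q z (g n z)) ∧
      ∀ n z, R n z (g n z) (g (n + 1) z) := by
  have : Nonempty C := ⟨c₀⟩
  have step : ∀ (n : ℕ) (g : {g : Z → C // Measurable g ∧ ∀ z, Q z (g z)}),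
      ∃ g' : {g : Z → C // Measurable g ∧ ∀ z, Q z (g z)}, ∀ z, R n z (g.1 z) (g'.1 z) := by
    rintro n ⟨g, hg, hgQ⟩
    obtain ⟨g', hg', h⟩ := exists_measurable_selector (fun z d => Q z d ∧ R n z (g z) d)
      (fun d => (hQ d).inter <| by
        have h : {z | R n z (g z) d} = ⋃ c, g ⁻¹' {c} ∩ {z | R n z c d} := by
          ext z
          simp
        change MeasurableSet {z | R n z (g z) d}
        rw [h]
        exact MeasurableSet.iUnion fun c => (hg (measurableSet_singleton c)).inter (hR n c d))
      fun z => hex n z _ (hgQ z)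
    exact ⟨⟨g', hg', fun z => (h z).1⟩, fun z => (h z).2⟩
  choose next hnext using step
  let g : ℕ → {g : Z → C // Measurable g ∧ ∀ z, Q z (g z)} :=
    Nat.rec ⟨fun _ => c₀, measurable_const, h₀⟩ next
  exact ⟨fun n => (g n).1, fun n => (g n).2.1, fun n => (g n).2.2, fun n => hnext n (g n)⟩

theorem IsQuasiPolish.exists_separating_seq {Y : Type*} [TopologicalSpace Y]
    (hY : IsQuasiPolish Y) :
    ∃ B : ℕ → Set Y, (∀ n, IsOpen (B n)) ∧ ∀ y y', (∀ n, y ∈ B n ↔ y' ∈ B n) → y = y' := by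
  obtain ⟨J, _, T, -, ⟨h⟩⟩ := hY
  obtain ⟨c, hc⟩ := exists_injective_nat J
  -- By injectivity of `c` the union has at most one term; it is empty off the range of `c`, so `J`
  -- may be finite or empty.
  refine ⟨fun n => ⋃ j ∈ {j | c j = n}, (fun y => (h y).1 j) ⁻¹' {True}, fun n => ?_, ?_⟩
  · exact isOpen_biUnion fun j _ => isOpen_singleton_true.preimage
      ((continuous_apply j).comp (continuous_subtype_val.comp h.continuous))
  · intro y y' hyy
    refine h.injective (Subtype.ext (funext fun j => propext ?_))
    simpa [hc.eq_iff] using hyy (c j)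

/-- A continuous open map from a quasi-Polish space to a space with a separating sequence of open
sets has a Borel section on its image. -/
theorem IsQuasiPolish.exists_measurable_section {X Y : Type*} [TopologicalSpace X]
    [TopologicalSpace Y] [MeasurableSpace X] [BorelSpace X] [MeasurableSpace Y]
    [OpensMeasurableSpace Y] (hX : IsQuasiPolish X) {B : ℕ → Set Y} (hB : ∀ n, IsOpen (B n))
    (hsep : ∀ y y', (∀ n, y ∈ B n ↔ y' ∈ B n) → y = y')
    {f : X → Y} (hf : Continuous f) (hfo : IsOpenMap f) :
    ∃ s : range f → X, Measurable s ∧ ∀ y : range f, f (s y) = (y : Y) := by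
  classical
  obtain ⟨I, _, S, ⟨U, V, hU, hV, hS⟩, ⟨h⟩⟩ := hX
  let e : X → I → Prop := fun x => (h x).1
  have he : Topology.IsEmbedding e := Topology.IsEmbedding.subtypeVal.comp h.isEmbedding
  have hmem : ∀ x n, e x ∈ U n → e x ∈ V n := fun x n hx => by
    have h1 : e x ∈ ⋂ n, ((U n)ᶜ ∪ V n) := hS ▸ (h x).2
    exact (mem_iInter.1 h1 n).resolve_left fun h2 => h2 hx
  choose W hW hWB using fun n => he.isOpen_iff.1 ((hB n).preimage hf)
  let D : Finset I → Set X := fun F => e ⁻¹' sierpinskiCylinder F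
  let Q : range f → Finset I → Prop := fun y F => (y : Y) ∈ f '' D F
  -- Through `unpair` each index recurs at arbitrarily late stages: the cylinder may enter `U` only
  -- late.
  let R : ℕ → range f → Finset I → Finset I → Prop := fun n y F G =>
    F ⊆ G ∧ (sierpinskiCylinder F ⊆ U n.unpair.1 → sierpinskiCylinder G ⊆ V n.unpair.1) ∧
      ((y : Y) ∈ B n.unpair.1 → sierpinskiCylinder G ⊆ W n.unpair.1)
  let _ : MeasurableSpace (Finset I) := ⊤
  obtain ⟨F, hFm, hFQ, hFR⟩ := exists_measurable_seq Q R
    (fun F => measurable_subtype_coe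
      (hfo _ ((isOpen_sierpinskiCylinder F).preimage he.continuous)).measurableSet)
    (fun n F G => by
      refine (MeasurableSet.const _).inter ((MeasurableSet.const _).inter ?_)
      exact MeasurableSet.imp (measurable_subtype_coe (hB _).measurableSet) (MeasurableSet.const _))
    ∅ (fun y => by
      obtain ⟨_, x, rfl⟩ := y
      exact ⟨x, fun i hi => by simp at hi, rfl⟩)
    (by
      rintro n ⟨_, hy⟩ F ⟨x, hxF, rfl⟩
      obtain ⟨G₁, hx₁, hG₁⟩ : ∃ G, e x ∈ sierpinskiCylinder G ∧
          (sierpinskiCylinder F ⊆ U n.unpair.1 → sierpinskiCylinder G ⊆ V n.unpair.1) := by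
        by_cases hFU : sierpinskiCylinder F ⊆ U n.unpair.1
        · obtain ⟨G, hx, hG⟩ :=
            exists_sierpinskiCylinder_subset (hV _) (hmem x _ (hFU hxF))
          exact ⟨G, hx, fun _ => hG⟩
        · exact ⟨F, hxF, fun h => absurd h hFU⟩
      obtain ⟨G₂, hx₂, hG₂⟩ : ∃ G, e x ∈ sierpinskiCylinder G ∧
          (f x ∈ B n.unpair.1 → sierpinskiCylinder G ⊆ W n.unpair.1) := by
        by_cases hxB : f x ∈ B n.unpair.1
        · have hxW : x ∈ e ⁻¹' W n.unpair.1 := by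
            rw [hWB]
            exact hxB
          obtain ⟨G, hx, hG⟩ := exists_sierpinskiCylinder_subset (hW _) hxW
          exact ⟨G, hx, fun _ => hG⟩
        · exact ⟨F, hxF, fun h => absurd h hxB⟩
      refine ⟨F ∪ (G₁ ∪ G₂), ⟨x, fun i hi => ?_, rfl⟩, Finset.subset_union_left,
        fun hFU => (sierpinskiCylinder_anti ?_).trans (hG₁ hFU),
        fun hxB => (sierpinskiCylinder_anti ?_).trans (hG₂ hxB)⟩
      · rcases Finset.mem_union.1 hi with hi | hi
        · exact hxF i hi
        · exact (Finset.mem_union.1 hi).elim (hx₁ i) (hx₂ i)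
      · exact Finset.subset_union_left.trans Finset.subset_union_right
      · exact Finset.subset_union_right.trans Finset.subset_union_right)
  have hmono : ∀ y, Monotone fun n => F n y := fun y =>
    monotone_nat_of_le_succ fun n => (hFR n y).1
  let p : range f → I → Prop := fun y i => ∃ k, i ∈ F k y
  have hp : ∀ y k, p y ∈ sierpinskiCylinder (F k y) := fun y k i hi => ⟨k, hi⟩
  have hpS : ∀ y, p y ∈ S := fun y => by
    rw [hS, mem_iInter]
    intro n
    by_cases hn : p y ∈ U n
    · right
      obtain ⟨k, hk⟩ := exists_sierpinskiCylinder_subset_of_monotone (hmono y) (hU n) hn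
      -- Stage `Nat.pair n k` treats index `n` and is at least `k`, so its cylinder already lies in
      -- `U n`.
      have hR := (hFR (Nat.pair n k) y).2.1
      simp only [Nat.unpair_pair] at hR
      exact hR ((sierpinskiCylinder_anti (hmono y (Nat.right_le_pair n k))).trans hk) (hp y _)
    · exact Or.inl hn
  let s : range f → X := fun y => h.symm ⟨p y, hpS y⟩
  have hes : ∀ y, e (s y) = p y := fun y => by simp [e, s]
  refine ⟨s, measurable_of_isOpen fun O hO => ?_, fun y => hsep _ _ fun n => ?_⟩
  · obtain ⟨O', hO', rfl⟩ := he.isOpen_iff.1 hO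
    have hpre : s ⁻¹' (e ⁻¹' O') = ⋃ k, F k ⁻¹' {G | sierpinskiCylinder G ⊆ O'} := by
      ext y
      simp only [mem_preimage, hes, mem_iUnion, mem_ofPred_eq]
      exact ⟨exists_sierpinskiCylinder_subset_of_monotone (hmono y) hO',
        fun ⟨k, hk⟩ => hk (hp y k)⟩
    rw [hpre]
    exact MeasurableSet.iUnion fun k => hFm k trivial
  · have hiff : ∀ x, e x ∈ W n ↔ f x ∈ B n := fun x => Set.ext_iff.1 (hWB n) x
    rw [← hiff, hes]
    constructor
    · intro hW'
      obtain ⟨k, hk⟩ := exists_sierpinskiCylinder_subset_of_monotone (hmono y) (hW n) hW'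
      -- The cylinder inside `W n` still contains a point of the fibre over `y`.
      obtain ⟨x, hx, hxy⟩ := hFQ k y
      rw [← hxy, ← hiff]
      exact hk hx
    · intro hy
      have hR := (hFR (Nat.pair n 0) y).2.2
      simp only [Nat.unpair_pair] at hR
      exact hR hy (hp y _)

theorem mainTheorem12 {X Y : Type*} [TopologicalSpace X] [TopologicalSpace Y]
    [MeasurableSpace X] [BorelSpace X] [MeasurableSpace Y] [BorelSpace Y]
    (hX : IsQuasiPolish X) (hY : IsQuasiPolish Y)
    (f : X → Y) (hf : Continuous f) (hfo : IsOpenMap f) :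
    ∃ s : Set.range f → X, Measurable s ∧ ∀ y : Set.range f, f (s y) = (y : Y) := by
  obtain ⟨B, hB, hsep⟩ := hY.exists_separating_seq
  exact hX.exists_measurable_section hB hsep hf hfo
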